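/- Let $0<s,\alpha<1$, $1<p<\infty$, $L\ge 0$ and $0<\sigma<\alpha s$. Let $\emptyset\neq G\subset\mathbb{R}^n$ be a bounded open set, and let $R:G\to\mathbb{R}$ be a function such that $|R(x)-R(y)|\le L|x-y|^\alpha$ for all $x,y\in G$ and $0\le R(x)\le \operatorname{dist}(x,\partial G)$ for every $x\in G$ (with $\operatorname{dist}(x,\emptyset)=\infty$). For $f\in L^p(G)$ and $x\in G$ put $$M_R(f)(x)=\sup_{0\le r\le R(x)}\frac{1}{|B(x,r)|}\int_{B(x,r)}|f(y)|\,dy,$$ where the average over $B(x,0)$ is understood to be $|f(x)|$, and for $0<t<1$ put $$|u|_{W^{t,p}(G)}=\left(\int_G\int_G\frac{|u(x)-u(y)|^p}{|x-y|^{n+tp}}\,dy\,dx\right)^{1/p}\in[0,\infty].$$ Then there exists a constant $C>0$, depending only on $\sigma,s,\alpha,n,p,L$ and $\operatorname{diam}(G)$, such that for every $f\in L^p(G)$ the function $M_R(f)$ is finite almost everywhere in $G$ and $$|M_R(f)|_{W^{\sigma,p}(G)}\le C\,|f|_{W^{s,p}(G)}.$$ -/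

import Mathlib

open MeasureTheory
open scoped ENNReal

/-- The average of `|f|` over the open ball `B(x, r)`, with the convention that
the average over `B(x, 0)` is `|f x|`. -/
noncomputable def ballAverage {n : ℕ} (f : EuclideanSpace ℝ (Fin n) → ℝ)
    (x : EuclideanSpace ℝ (Fin n)) (r : ℝ) : ℝ≥0∞ :=
  if r = 0 then ‖f x‖ₑ else ⨍⁻ y in Metric.ball x r, ‖f y‖ₑ ∂volume

/-- The centred maximal function `M_R f (x)`: the supremum of the averages of `|f|` over
the balls `B(x, r)` with `0 ≤ r ≤ R x`, as an extended nonnegative number. -/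
noncomputable def maximalR {n : ℕ} (R : EuclideanSpace ℝ (Fin n) → ℝ)
    (f : EuclideanSpace ℝ (Fin n) → ℝ) (x : EuclideanSpace ℝ (Fin n)) : ℝ≥0∞ :=
  ⨆ r ∈ Set.Icc 0 (R x), ballAverage f x r

/-- The fractional Sobolev (Gagliardo) seminorm `|u|_{W^{s,p}(G)}`, possibly infinite.
On the diagonal `x = y` the integrand is zero. -/
noncomputable def fracSeminorm {n : ℕ} (G : Set (EuclideanSpace ℝ (Fin n))) (s p : ℝ)
    (u : EuclideanSpace ℝ (Fin n) → ℝ) : ℝ≥0∞ :=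
  (∫⁻ x in G, ∫⁻ y in G,
    ENNReal.ofReal (|u x - u y| ^ p / ‖x - y‖ ^ ((n : ℝ) + s * p))) ^ (1 / p)

/-! Let g be the fractional gradient `fracGrad` of f, whose L^p norm on G is the W^{s,p} seminorm.
Averaging through a ball of radius t/2 inside G gives the Hajłasz-type bound |f(a)-f(b)| ≤ C t^s
(g(a)+g(b)) when |a-b| ≤ 3t/2 (`enorm_sub_le_fracGrad`). For x, y in G take t = Λ|x-y|^α with Λ so
large that 2|x-y| ≤ t and R(x) ≤ R(y)+t. If t ≤ r ≤ R(x), the radius r-t is admissible at y, and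
x+rz is compared with y+(r-t)z for z in the unit ball; averaging in z turns g into its maximal
function (`ballAverage_le_of_le_radius`). If r < t, the average is close to |f(x)|, which is
compared with |f(y)|, the radius-zero average at y. By symmetry (`maximalR_le_add`), |M_R f(x) - M_R
f(y)| ≤ C|x-y|^{αs}(Φ(x)+Φ(y)) + |f(x)-f(y)|, with Φ = g + Mg. Divide by |x-y|^{n/p+σ} and take L^p
norms. Since σ < αs, the kernel |x-y|^{(αs-σ)p-n} is integrable on bounded sets, and the
Hardy-Littlewood theorem controls Φ; since σ < s, the last term costs only a power of the diameter.
-/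

/-! ### Truncated maximal function and its weak type (1,1) bound. -/

section MaximalFunction

open Metric Set

variable {E : Type*} [NormedAddCommGroup E] [MeasurableSpace E]

/-- The centred Hardy-Littlewood maximal function over balls of radius at most `D`. -/
noncomputable def truncMax (μ : Measure E) (D : ℝ) (g : E → ℝ≥0∞) (x : E) : ℝ≥0∞ :=
  ⨆ r ∈ Ioc 0 D, ⨍⁻ y in ball x r, g y ∂μ

theorem laverage_ball_le_truncMax (μ : Measure E) {D r : ℝ} (hr : 0 < r) (hrD : r ≤ D)
    (g : E → ℝ≥0∞) (x : E) : ⨍⁻ y in ball x r, g y ∂μ ≤ truncMax μ D g x :=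
  le_iSup₂_of_le (f := fun r (_ : r ∈ Ioc 0 D) => ⨍⁻ y in ball x r, g y ∂μ) r ⟨hr, hrD⟩ le_rfl

/-- An open ball is exhausted by smaller concentric balls, and each of these stays inside the ball
of radius r about any nearby centre. No measurability of g is needed. -/
theorem lowerSemicontinuous_setLIntegral_ball (μ : Measure E) (g : E → ℝ≥0∞) (r : ℝ) :
    LowerSemicontinuous fun x => ∫⁻ y in ball x r, g y ∂μ := by
  intro x a ha
  have hU : ball x r = ⋃ k : ℕ, ball x (r - 1 / ((k : ℝ) + 1)) := by
    ext y
    simp only [mem_ball, mem_iUnion]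
    refine ⟨fun h => ?_, fun ⟨k, hk⟩ => hk.trans (sub_lt_self _ Nat.one_div_pos_of_nat)⟩
    obtain ⟨k, hk⟩ := exists_nat_one_div_lt (sub_pos.2 h)
    exact ⟨k, by linarith⟩
  have hmono : Monotone fun k : ℕ => ball x (r - 1 / ((k : ℝ) + 1)) := fun i j hij =>
    ball_subset_ball (sub_le_sub_left (Nat.one_div_le_one_div hij) _)
  change a < ∫⁻ y in ball x r, g y ∂μ at ha
  rw [hU, setLIntegral_iUnion_of_directed _ hmono.directed_le] at ha
  obtain ⟨k, hk⟩ := lt_iSup_iff.1 ha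
  filter_upwards [ball_mem_nhds x (Nat.one_div_pos_of_nat (α := ℝ) (n := k))] with z hz
  refine hk.trans_le (lintegral_mono_set ?_)
  refine ball_subset_ball' ?_
  rw [dist_comm]
  have := mem_ball.1 hz
  linarith

/-- Splitting g at height a: this is the truncation step of Marcinkiewicz interpolation. -/
theorem truncMax_le_add [NormedSpace ℝ E] [FiniteDimensional ℝ E] (μ : Measure E)
    [μ.IsAddHaarMeasure] (D : ℝ)
    (g : E → ℝ≥0∞) (a : ℝ≥0∞) (x : E) :
    truncMax μ D g x ≤ a + truncMax μ D ({x | a < g x}.indicator g) x := by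
  refine iSup₂_le fun r hr => ?_
  have h0 : μ (ball x r) ≠ 0 := (measure_ball_pos μ x hr.1).ne'
  refine le_trans ?_ (add_le_add_right (laverage_ball_le_truncMax μ hr.1 hr.2 _ x) a)
  have : NeZero (μ.restrict (ball x r)) := ⟨by simpa using h0⟩
  have : IsFiniteMeasure (μ.restrict (ball x r)) := ⟨by simpa using measure_ball_lt_top⟩
  conv_rhs => lhs; rw [← laverage_const (μ.restrict (ball x r)) a]
  simp only [laverage_eq, ← ENNReal.add_div]
  gcongr
  rw [← lintegral_add_left measurable_const]
  refine lintegral_mono fun y => ?_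
  by_cases h : a < g y
  · simp [h]
  · exact (not_lt.1 h).trans le_self_add

variable [BorelSpace E]

theorem lowerSemicontinuous_truncMax (μ : Measure E) [μ.IsAddHaarMeasure] (D : ℝ)
    (g : E → ℝ≥0∞) : LowerSemicontinuous (truncMax μ D g) := by
  refine lowerSemicontinuous_biSup fun r hr x a ha => ?_
  simp only [setLAverage_eq, Measure.addHaar_ball_center μ _ r] at ha ⊢
  have h0 : μ (ball (0 : E) r) ≠ 0 := (measure_ball_pos μ 0 hr.1).ne'
  exact (ENNReal.continuous_div_const _ h0).comp_lowerSemicontinuous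
    (lowerSemicontinuous_setLIntegral_ball μ g r) (fun _ _ h => ENNReal.div_le_div_right h _) x a ha

theorem measurable_truncMax (μ : Measure E) [μ.IsAddHaarMeasure] (D : ℝ) (g : E → ℝ≥0∞) :
    Measurable (truncMax μ D g) := (lowerSemicontinuous_truncMax μ D g).measurable

variable [NormedSpace ℝ E] [FiniteDimensional ℝ E]

/-- Vitali covering: disjoint balls carrying average at least a, enlarged four times, cover the
level set. The truncation at D supplies the bounded radii that the covering lemma requires. -/
theorem measure_lt_truncMax_le (μ : Measure E) [μ.IsAddHaarMeasure] (D : ℝ) (g : E → ℝ≥0∞)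
    {a : ℝ≥0∞} (ha : a ≠ 0) (ha' : a ≠ ∞) :
    μ {x | a < truncMax μ D g x} ≤
      ENNReal.ofReal (4 ^ Module.finrank ℝ E) * (∫⁻ x, g x ∂μ) / a := by
  set S := {x | a < truncMax μ D g x}
  have hex : ∀ x ∈ S, ∃ r, r ∈ Ioc 0 D ∧ a * μ (ball x r) ≤ ∫⁻ y in ball x r, g y ∂μ := by
    intro x hx
    obtain ⟨r, hr⟩ := lt_iSup_iff.1 (show a < truncMax μ D g x from hx)
    obtain ⟨hr, h⟩ := lt_iSup_iff.1 hr
    refine ⟨r, hr, ?_⟩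
    rw [setLAverage_eq] at h
    exact ENNReal.mul_le_of_le_div h.le
  choose! r hr hint using hex
  obtain ⟨u, huS, hdisj, hcov⟩ := Vitali.exists_disjoint_subfamily_covering_enlargement_ball S
    (fun x => x) r D (fun x hx => (hr x hx).2) 4 (by norm_num)
  have hcount : u.Countable := hdisj.countable_of_isOpen (fun _ _ => isOpen_ball)
    fun x hx => nonempty_ball.2 (hr x (huS hx)).1
  have hsub : S ⊆ ⋃ x ∈ u, ball x (4 * r x) := fun x hx => by
    obtain ⟨b, hb, h⟩ := hcov x hx
    exact mem_biUnion hb (h (mem_ball_self (hr x hx).1))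
  rw [ENNReal.le_div_iff_mul_le (Or.inl ha) (Or.inl ha')]
  calc μ S * a ≤ (∑' x : u, μ (ball (x : E) (4 * r x))) * a := by
        gcongr
        have := hcount.to_subtype
        exact (measure_mono hsub).trans (measure_biUnion_le μ hcount _)
    _ = ∑' x : u, ENNReal.ofReal (4 ^ Module.finrank ℝ E) * (a * μ (ball (x : E) (r x))) := by
        rw [← ENNReal.tsum_mul_right]
        refine tsum_congr fun x => ?_
        rw [Measure.addHaar_ball_mul_of_pos μ _ (by norm_num), Measure.addHaar_ball_center μ (x : E)]
        ring
    _ ≤ ENNReal.ofReal (4 ^ Module.finrank ℝ E) * ∑' x : u, ∫⁻ y in ball (x : E) (r x), g y ∂μ := by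
        rw [ENNReal.tsum_mul_left]
        gcongr with x
        exact hint x (huS x.2)
    _ ≤ _ := by
        rw [← lintegral_biUnion hcount (fun _ _ => measurableSet_ball) hdisj]
        gcongr
        exact Measure.restrict_le_self

end MaximalFunction

/-! ### Layer-cake formula for extended nonnegative functions. -/

section LayerCake

open Set

theorem lintegral_Ioi_indicator_rpow {q : ℝ} (hq : 0 < q) (a : ℝ≥0∞) :
    ∫⁻ t in Ioi (0 : ℝ), ENNReal.ofReal (q * t ^ (q - 1)) *
      {t : ℝ | ENNReal.ofReal t < a}.indicator 1 t = a ^ q := by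
  have fin : ∀ b : ℝ, 0 ≤ b → ∫⁻ t in Ioi (0 : ℝ), ENNReal.ofReal (q * t ^ (q - 1)) *
      {t : ℝ | ENNReal.ofReal t < ENNReal.ofReal b}.indicator 1 t = ENNReal.ofReal b ^ q := by
    intro b hb
    have h1 : ∀ t ∈ Ioi (0 : ℝ), ENNReal.ofReal (q * t ^ (q - 1)) *
        {t : ℝ | ENNReal.ofReal t < ENNReal.ofReal b}.indicator 1 t =
        (Iio b).indicator (fun t => ENNReal.ofReal (q * t ^ (q - 1))) t := by
      intro t ht
      have : ENNReal.ofReal t < ENNReal.ofReal b ↔ t < b :=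
        ENNReal.ofReal_lt_ofReal_iff_of_nonneg (le_of_lt ht)
      by_cases h : t < b <;> simp [indicator, this, h]
    rw [setLIntegral_congr_fun measurableSet_Ioi h1, lintegral_indicator measurableSet_Iio,
      Measure.restrict_restrict measurableSet_Iio, Iio_inter_Ioi]
    have hint : IntervalIntegrable (fun t : ℝ => q * t ^ (q - 1)) volume 0 b :=
      (intervalIntegral.intervalIntegrable_rpow' (by linarith)).const_mul q
    rw [← setLIntegral_congr Ioo_ae_eq_Ioc.symm, ← ofReal_integral_eq_lintegral_ofReal
      ((intervalIntegrable_iff_integrableOn_Ioc_of_le hb).1 hint) ?_,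
      ← intervalIntegral.integral_of_le hb, intervalIntegral.integral_const_mul,
      integral_rpow (Or.inl (by linarith))]
    · rw [ENNReal.ofReal_rpow_of_nonneg hb hq.le]
      congr 1
      rw [sub_add_cancel, Real.zero_rpow hq.ne']
      field_simp
      ring
    · filter_upwards [ae_restrict_mem measurableSet_Ioc] with t ht
      have := ht.1
      simp only [Pi.zero_apply]
      positivity
  rcases eq_or_ne a ∞ with rfl | ha
  -- At a = ∞ the integral exceeds every finite c, because it dominates the integral for the finite
  -- level c^(1/q) + 1.
  · rw [ENNReal.top_rpow_of_pos hq, eq_top_iff]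
    refine le_of_forall_lt fun c hc => ?_
    have hc' : c ^ (1 / q) < ENNReal.ofReal ((c ^ (1 / q)).toReal + 1) := by
      have hne : c ^ (1 / q) ≠ ∞ := ENNReal.rpow_ne_top_of_nonneg (by positivity) hc.ne
      rw [← ENNReal.toReal_lt_toReal hne ENNReal.ofReal_ne_top, ENNReal.toReal_ofReal (by positivity)]
      linarith
    calc c = (c ^ (1 / q)) ^ q := by rw [← ENNReal.rpow_mul, one_div_mul_cancel hq.ne', ENNReal.rpow_one]
      _ < ENNReal.ofReal ((c ^ (1 / q)).toReal + 1) ^ q := ENNReal.rpow_lt_rpow hc' hq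
      _ ≤ _ := by
        rw [← fin _ (by positivity)]
        refine lintegral_mono fun t => ?_
        gcongr
        exact le_top
  · have := fin a.toReal ENNReal.toReal_nonneg
    rwa [ENNReal.ofReal_toReal ha] at this

theorem lintegral_rpow_eq_layercake {α : Type*} [MeasurableSpace α] (μ : Measure α) [SFinite μ]
    {h : α → ℝ≥0∞} (hh : Measurable h) {q : ℝ} (hq : 0 < q) :
    ∫⁻ x, h x ^ q ∂μ =
      ∫⁻ t in Ioi (0 : ℝ), ENNReal.ofReal (q * t ^ (q - 1)) * μ {x | ENNReal.ofReal t < h x} := by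
  simp_rw [← lintegral_Ioi_indicator_rpow hq]
  have hm : MeasurableSet {z : α × ℝ | ENNReal.ofReal z.2 < h z.1} :=
    measurableSet_lt (by fun_prop) (by fun_prop)
  rw [lintegral_lintegral_swap]
  · refine lintegral_congr fun t => ?_
    rw [lintegral_const_mul]
    · congr 1
      have hmt : MeasurableSet {x | ENNReal.ofReal t < h x} := measurableSet_lt measurable_const hh
      rw [← lintegral_indicator_one hmt]
      rfl
    · exact (measurable_const (a := (1 : ℝ≥0∞))).indicator (measurableSet_lt measurable_const hh)
  · refine Measurable.aemeasurable (Measurable.mul (by fun_prop) ?_)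
    exact (measurable_const (a := (1 : ℝ≥0∞))).indicator hm

end LayerCake

/-! ### Strong type (p,p) by interpolation. -/

section StrongType

open Metric Set

variable {E : Type*} [NormedAddCommGroup E] [MeasurableSpace E] [BorelSpace E]
  [NormedSpace ℝ E] [FiniteDimensional ℝ E]

/-- The Hardy-Littlewood maximal theorem. -/
theorem lintegral_truncMax_rpow_le (μ : Measure E) [μ.IsAddHaarMeasure] {p : ℝ} (hp : 1 < p) :
    ∃ C : ℝ≥0∞, C ≠ ∞ ∧ ∀ (D : ℝ) (g : E → ℝ≥0∞), Measurable g →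
      ∫⁻ x, truncMax μ D g x ^ p ∂μ ≤ C * ∫⁻ x, g x ^ p ∂μ := by
  set A := ENNReal.ofReal (4 ^ Module.finrank ℝ E)
  have hp1 : 0 < p - 1 := by linarith
  -- `A` is the weak-type constant; 2p/(p-1) converts p t^(p-1) · 2/t into the layer-cake density of
  -- exponent p-1; 2^(p-1) comes from (2g)^(p-1).
  refine ⟨A * ENNReal.ofReal (2 * p / (p - 1)) * 2 ^ (p - 1),
    ENNReal.mul_ne_top (ENNReal.mul_ne_top ENNReal.ofReal_ne_top ENNReal.ofReal_ne_top)
      (ENNReal.rpow_ne_top_of_nonneg hp1.le ENNReal.ofNat_ne_top), fun D g hg => ?_⟩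
  have hm : MeasurableSet {z : ℝ × E | ENNReal.ofReal z.1 < 2 * g z.2} :=
    measurableSet_lt (by fun_prop) (by fun_prop)
  -- Weak type at height t/2, applied to the part of g above t/2.
  have key : ∀ t ∈ Ioi (0 : ℝ), μ {x | ENNReal.ofReal t < truncMax μ D g x} ≤
      ENNReal.ofReal (2 / t) * (A * ∫⁻ x, g x * {t : ℝ | ENNReal.ofReal t < 2 * g x}.indicator 1 t ∂μ) := by
    intro t ht
    have ht0 : 0 < t := ht
    have hhalf : ENNReal.ofReal t = ENNReal.ofReal (t / 2) + ENNReal.ofReal (t / 2) := by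
      rw [← ENNReal.ofReal_add (by positivity) (by positivity), add_halves]
    calc μ {x | ENNReal.ofReal t < truncMax μ D g x}
        ≤ μ {x | ENNReal.ofReal (t / 2) <
            truncMax μ D ({x | ENNReal.ofReal (t / 2) < g x}.indicator g) x} := by
          refine measure_mono fun x hx => ?_
          have h := lt_of_lt_of_le hx (truncMax_le_add μ D g (ENNReal.ofReal (t / 2)) x)
          rw [hhalf] at h
          exact (ENNReal.add_lt_add_iff_left ENNReal.ofReal_ne_top).1 h
      _ ≤ _ := measure_lt_truncMax_le μ D _ (by simpa using ht0) ENNReal.ofReal_ne_top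
      _ = _ := by
          have h1 : ∀ x, {x | ENNReal.ofReal (t / 2) < g x}.indicator g x =
              g x * {t : ℝ | ENNReal.ofReal t < 2 * g x}.indicator 1 t := by
            intro x
            have : ENNReal.ofReal (t / 2) < g x ↔ ENNReal.ofReal t < 2 * g x := by
              rw [ENNReal.ofReal_div_of_pos two_pos, ENNReal.ofReal_ofNat, mul_comm,
                ENNReal.div_lt_iff (by simp) (by simp)]
            by_cases h : ENNReal.ofReal t < 2 * g x <;> simp [indicator, this, h]
          simp_rw [h1]
          rw [ENNReal.div_eq_inv_mul, ← ENNReal.ofReal_inv_of_pos (by positivity), inv_div]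
  rw [lintegral_rpow_eq_layercake μ (measurable_truncMax μ D g) (by linarith)]
  calc ∫⁻ t in Ioi (0 : ℝ), ENNReal.ofReal (p * t ^ (p - 1)) *
        μ {x | ENNReal.ofReal t < truncMax μ D g x}
      ≤ ∫⁻ t in Ioi (0 : ℝ), ∫⁻ x, A * ENNReal.ofReal (2 * p / (p - 1)) *
          (g x * (ENNReal.ofReal ((p - 1) * t ^ (p - 1 - 1)) *
            {t : ℝ | ENNReal.ofReal t < 2 * g x}.indicator 1 t)) ∂μ := by
        refine setLIntegral_mono' measurableSet_Ioi fun t ht => ?_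
        have ht0 : 0 < t := ht
        have hmt : Measurable fun x => {t : ℝ | ENNReal.ofReal t < 2 * g x}.indicator
            (1 : ℝ → ℝ≥0∞) t :=
          (measurable_const (a := (1 : ℝ≥0∞))).indicator (measurableSet_lt measurable_const (by fun_prop))
        have hc : ENNReal.ofReal (p * t ^ (p - 1)) * ENNReal.ofReal (2 / t) =
            ENNReal.ofReal (2 * p / (p - 1)) * ENNReal.ofReal ((p - 1) * t ^ (p - 1 - 1)) := by
          rw [← ENNReal.ofReal_mul (by positivity), ← ENNReal.ofReal_mul (by positivity),
            Real.rpow_sub_one ht0.ne' (p - 1)]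
          congr 1
          field_simp
        calc _ ≤ ENNReal.ofReal (p * t ^ (p - 1)) * (ENNReal.ofReal (2 / t) * (A * ∫⁻ x, g x *
                {t : ℝ | ENNReal.ofReal t < 2 * g x}.indicator 1 t ∂μ)) := by
              gcongr; exact key t ht
          _ = A * ENNReal.ofReal (2 * p / (p - 1)) * ENNReal.ofReal ((p - 1) * t ^ (p - 1 - 1)) *
              ∫⁻ x, g x * {t : ℝ | ENNReal.ofReal t < 2 * g x}.indicator 1 t ∂μ := by
              rw [← mul_assoc, hc]; ring
          _ = _ := by
              rw [← lintegral_const_mul _ (f := fun x => g x * _) (hg.mul hmt)]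
              refine lintegral_congr fun x => by ring
    _ = ∫⁻ x, (∫⁻ t in Ioi (0 : ℝ), A * ENNReal.ofReal (2 * p / (p - 1)) *
          (g x * (ENNReal.ofReal ((p - 1) * t ^ (p - 1 - 1)) *
            {t : ℝ | ENNReal.ofReal t < 2 * g x}.indicator 1 t))) ∂μ := by
        rw [lintegral_lintegral_swap]
        refine Measurable.aemeasurable (Measurable.const_mul (Measurable.mul (by fun_prop)
          (Measurable.mul (by fun_prop) ?_)) _)
        exact (measurable_const (a := (1 : ℝ≥0∞))).indicator hm
    _ = ∫⁻ x, A * ENNReal.ofReal (2 * p / (p - 1)) * (g x * (2 * g x) ^ (p - 1)) ∂μ := by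
        refine lintegral_congr fun x => ?_
        have hmt : Measurable fun t : ℝ => {t : ℝ | ENNReal.ofReal t < 2 * g x}.indicator
            (1 : ℝ → ℝ≥0∞) t :=
          measurable_one.indicator (measurableSet_lt (by fun_prop) measurable_const)
        rw [lintegral_const_mul _ (by fun_prop), lintegral_const_mul _ (by fun_prop),
          lintegral_Ioi_indicator_rpow hp1]
    _ = ∫⁻ x, A * ENNReal.ofReal (2 * p / (p - 1)) * 2 ^ (p - 1) * g x ^ p ∂μ := by
        refine lintegral_congr fun x => ?_
        rw [ENNReal.mul_rpow_of_nonneg _ _ hp1.le, mul_assoc _ (2 ^ (p - 1))]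
        congr 1
        rw [mul_left_comm]
        congr 1
        nth_rewrite 1 [← ENNReal.rpow_one (g x)]
        rw [← ENNReal.rpow_add_of_nonneg _ _ zero_le_one hp1.le, add_sub_cancel]
    _ = _ := by rw [lintegral_const_mul _ (by fun_prop)]

end StrongType

/-! ### Balls rescaled to the unit ball, and Jensen's inequality. -/

section Scaling

open Metric Set

variable {E : Type*} [NormedAddCommGroup E] [MeasurableSpace E] [BorelSpace E]
  [NormedSpace ℝ E] [FiniteDimensional ℝ E]

theorem addHaar_ball_eq_ofReal_rpow_mul (μ : Measure E) [μ.IsAddHaarMeasure] (x : E) {r : ℝ}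
    (hr : 0 < r) :
    μ (ball x r) = ENNReal.ofReal (r ^ (Module.finrank ℝ E : ℝ)) * μ (ball 0 1) := by
  have := Measure.addHaar_ball_mul_of_pos μ x hr 1
  rwa [mul_one, ← Real.rpow_natCast] at this

/-- Puts averages over balls of different centres and radii on one domain, so that they can be
compared pointwise. -/
theorem setLAverage_ball_eq_unitBall (μ : Measure E) [μ.IsAddHaarMeasure] (x : E) {r : ℝ}
    (hr : 0 < r) {F : E → ℝ≥0∞} (hF : Measurable F) :
    ⨍⁻ y in ball x r, F y ∂μ = ⨍⁻ z in ball (0 : E) 1, F (x + r • z) ∂μ := by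
  have hm : Measurable fun z : E => x + r • z := by fun_prop
  have hpre : (fun z : E => x + r • z) ⁻¹' ball x r = ball 0 1 := by
    ext z
    simp [norm_smul, abs_of_pos hr, hr]
  have hmap : Measure.map (fun z : E => x + r • z) μ =
      ENNReal.ofReal |(r ^ Module.finrank ℝ E)⁻¹| • μ := by
    have : (fun z : E => x + r • z) = (fun z => x + z) ∘ fun z => r • z := rfl
    rw [this, ← Measure.map_map (by fun_prop) (by fun_prop), Measure.map_addHaar_smul μ hr.ne',
      Measure.map_smul, map_add_left_eq_self]
  have h1 := setLIntegral_map (μ := μ) (measurableSet_ball (x := x) (ε := r)) hF hm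
  have h2 := Measure.addHaar_ball_mul_of_pos μ x hr 1
  rw [hmap, hpre, Measure.restrict_smul, lintegral_smul_measure, smul_eq_mul] at h1
  have hpos : 0 < r ^ Module.finrank ℝ E := by positivity
  rw [mul_one] at h2
  rw [setLAverage_eq, setLAverage_eq, ← h1, h2, abs_of_pos (by positivity),
    ENNReal.ofReal_inv_of_pos hpos, ENNReal.div_eq_inv_mul, ENNReal.div_eq_inv_mul,
    ENNReal.mul_inv (Or.inl (by simpa using hpos)) (Or.inl ENNReal.ofReal_ne_top)]
  ring

theorem laverage_le_rpow_laverage_rpow {α : Type*} [MeasurableSpace α] (μ : Measure α)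
    [IsFiniteMeasure μ] [NeZero μ] {f : α → ℝ} (hf : Measurable f) {p : ℝ} (hp : 1 ≤ p) :
    ⨍⁻ x, ‖f x‖ₑ ∂μ ≤ (⨍⁻ x, ‖f x‖ₑ ^ p ∂μ) ^ (1 / p) := by
  have := eLpNorm'_le_eLpNorm'_of_exponent_le one_pos hp ((μ Set.univ)⁻¹ • μ)
    hf.aestronglyMeasurable
  simpa [eLpNorm', laverage] using this

end Scaling

/-! ### Fractional gradient and the pointwise estimate for the maximal function. -/

section FractionalGradient

open Metric Set

variable {n : ℕ}

/-- The Gagliardo difference quotient integrated in the second variable. -/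
noncomputable def fracGrad (G : Set (EuclideanSpace ℝ (Fin n))) (s p : ℝ)
    (f : EuclideanSpace ℝ (Fin n) → ℝ) (x : EuclideanSpace ℝ (Fin n)) : ℝ≥0∞ :=
  (∫⁻ y in G, ENNReal.ofReal (|f x - f y| ^ p / ‖x - y‖ ^ ((n : ℝ) + s * p))) ^ (1 / p)

theorem measurable_fracGrad (G : Set (EuclideanSpace ℝ (Fin n))) (s p : ℝ)
    {f : EuclideanSpace ℝ (Fin n) → ℝ} (hf : Measurable f) : Measurable (fracGrad G s p f) := by
  refine Measurable.pow_const ?_ _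
  refine Measurable.lintegral_prod_right' (f := fun z : _ × _ =>
    ENNReal.ofReal (|f z.1 - f z.2| ^ p / ‖z.1 - z.2‖ ^ ((n : ℝ) + s * p))) ?_
  fun_prop

theorem fracSeminorm_rpow (G : Set (EuclideanSpace ℝ (Fin n))) (s : ℝ) {p : ℝ} (hp : 0 < p)
    (f : EuclideanSpace ℝ (Fin n) → ℝ) :
    fracSeminorm G s p f ^ p = ∫⁻ x in G, fracGrad G s p f x ^ p := by
  simp only [fracSeminorm, fracGrad, ← ENNReal.rpow_mul, one_div_mul_cancel hp.ne', ENNReal.rpow_one]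

/-- The constant in the Poincaré type estimate `setLAverage_enorm_sub_le`. -/
noncomputable def poincareConst (n : ℕ) (s p : ℝ) : ℝ≥0∞ :=
  (ENNReal.ofReal (4 ^ ((n : ℝ) + s * p)) /
    volume (ball (0 : EuclideanSpace ℝ (Fin n)) 1)) ^ (1 / p)

theorem poincareConst_ne_top (n : ℕ) (s : ℝ) {p : ℝ} (hp : 0 < p) : poincareConst n s p ≠ ∞ :=
  ENNReal.rpow_ne_top_of_nonneg (by positivity)
    (ENNReal.div_ne_top ENNReal.ofReal_ne_top (measure_ball_pos _ _ one_pos).ne')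

/-- Jensen, then insertion of the Gagliardo kernel at the cost of (4τ)^(n+sp); dividing by the
volume, of order τ^n, leaves τ^(sp). The point a may lie outside the ball. -/
theorem setLAverage_enorm_sub_le {G : Set (EuclideanSpace ℝ (Fin n))} {s p : ℝ} (hs : 0 < s)
    (hp : 1 < p) {f : EuclideanSpace ℝ (Fin n) → ℝ} (hf : Measurable f)
    {a b : EuclideanSpace ℝ (Fin n)} {τ : ℝ} (hτ : 0 < τ) (hG : ball b τ ⊆ G)
    (ha : ∀ c ∈ ball b τ, ‖a - c‖ ≤ 4 * τ) :
    ⨍⁻ c in ball b τ, ‖f a - f c‖ₑ ∂volume ≤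
      poincareConst n s p * ENNReal.ofReal (τ ^ s) * fracGrad G s p f a := by
  have hp0 : 0 < p := by linarith
  set q : ℝ := (n : ℝ) + s * p with hq
  have hq0 : 0 < q := by positivity
  have hne : NeZero (volume.restrict (ball b τ)) :=
    ⟨by simpa using (measure_ball_pos volume b hτ).ne'⟩
  have hfin : IsFiniteMeasure (volume.restrict (ball b τ)) := ⟨by simpa using measure_ball_lt_top⟩
  have hpt : ∀ c ∈ ball b τ, ‖f a - f c‖ₑ ^ p ≤ ENNReal.ofReal ((4 * τ) ^ q) *
      ENNReal.ofReal (|f a - f c| ^ p / ‖a - c‖ ^ q) := by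
    intro c hc
    rw [Real.enorm_eq_ofReal_abs, ENNReal.ofReal_rpow_of_nonneg (abs_nonneg _) hp0.le,
      ← ENNReal.ofReal_mul (by positivity)]
    refine ENNReal.ofReal_le_ofReal ?_
    rcases eq_or_ne a c with rfl | hac
    · simp [Real.zero_rpow hp0.ne']
    · have h0 : 0 < ‖a - c‖ := norm_pos_iff.2 (sub_ne_zero.2 hac)
      have h1 : 0 < ‖a - c‖ ^ q := by positivity
      have h2 : ‖a - c‖ ^ q ≤ (4 * τ) ^ q := Real.rpow_le_rpow h0.le (ha c hc) hq0.le
      rw [← mul_div_assoc, le_div_iff₀ h1, mul_comm]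
      gcongr
  calc ⨍⁻ c in ball b τ, ‖f a - f c‖ₑ ∂volume
      ≤ (⨍⁻ c in ball b τ, ‖f a - f c‖ₑ ^ p ∂volume) ^ (1 / p) :=
        laverage_le_rpow_laverage_rpow _ (by fun_prop) hp.le
    _ ≤ (ENNReal.ofReal ((4 * τ) ^ q) * (∫⁻ c in G, ENNReal.ofReal (|f a - f c| ^ p / ‖a - c‖ ^ q)) /
          volume (ball b τ)) ^ (1 / p) := by
        rw [setLAverage_eq]
        gcongr
        refine (setLIntegral_mono' measurableSet_ball hpt).trans ?_
        rw [lintegral_const_mul' _ _ ENNReal.ofReal_ne_top]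
        gcongr
    _ = (ENNReal.ofReal (4 ^ q) / volume (ball (0 : EuclideanSpace ℝ (Fin n)) 1) *
          ENNReal.ofReal (τ ^ s) ^ p *
          ∫⁻ c in G, ENNReal.ofReal (|f a - f c| ^ p / ‖a - c‖ ^ q)) ^ (1 / p) := by
        congr 1
        have h1 : 0 < τ ^ (n : ℝ) := by positivity
        rw [addHaar_ball_eq_ofReal_rpow_mul volume b hτ, finrank_euclideanSpace_fin,
          Real.mul_rpow (by norm_num) hτ.le, hq, Real.rpow_add hτ, ← mul_assoc,
          ENNReal.ofReal_mul (by positivity), ENNReal.ofReal_mul (by positivity),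
          ENNReal.ofReal_rpow_of_nonneg (by positivity) hp0.le, ← Real.rpow_mul hτ.le,
          ENNReal.div_eq_inv_mul, ENNReal.div_eq_inv_mul,
          ENNReal.mul_inv (Or.inl (by simpa using h1)) (Or.inl ENNReal.ofReal_ne_top)]
        have h2 : (ENNReal.ofReal (τ ^ (n : ℝ)))⁻¹ * ENNReal.ofReal (τ ^ (n : ℝ)) = 1 :=
          ENNReal.inv_mul_cancel (by simpa using h1) ENNReal.ofReal_ne_top
        calc _ = ((ENNReal.ofReal (τ ^ (n : ℝ)))⁻¹ * ENNReal.ofReal (τ ^ (n : ℝ))) *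
            ((volume (ball (0 : EuclideanSpace ℝ (Fin n)) 1))⁻¹ *
              ENNReal.ofReal (4 ^ ((n : ℝ) + s * p)) * ENNReal.ofReal (τ ^ (s * p)) *
              ∫⁻ c in G, ENNReal.ofReal (|f a - f c| ^ p / ‖a - c‖ ^ ((n : ℝ) + s * p))) := by ring
          _ = _ := by rw [h2, one_mul]
    _ = _ := by
        rw [ENNReal.mul_rpow_of_nonneg _ _ (by positivity),
          ENNReal.mul_rpow_of_nonneg _ _ (by positivity), ← ENNReal.rpow_mul (ENNReal.ofReal _),
          mul_one_div_cancel hp0.ne', ENNReal.rpow_one]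
        rfl

/-- The sum of the gradient on `G` and its maximal function. -/
noncomputable def fracGradMax (G : Set (EuclideanSpace ℝ (Fin n))) (s p D : ℝ)
    (f : EuclideanSpace ℝ (Fin n) → ℝ) (x : EuclideanSpace ℝ (Fin n)) : ℝ≥0∞ :=
  G.indicator (fracGrad G s p f) x + truncMax volume D (G.indicator (fracGrad G s p f)) x

variable {G : Set (EuclideanSpace ℝ (Fin n))} {s p D : ℝ} {f : EuclideanSpace ℝ (Fin n) → ℝ}

/-- Both values are compared with f(c), averaged over c in the ball at b. Only that ball must lie in
G; points c are within 3t/2 + t/2 = 4(t/2) of a. -/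
theorem enorm_sub_le_fracGrad (hs : 0 < s) (hp : 1 < p) (hf : Measurable f)
    {a b : EuclideanSpace ℝ (Fin n)} {t : ℝ} (ht : 0 < t) (hG : ball b (t / 2) ⊆ G)
    (hab : ‖a - b‖ ≤ 3 / 2 * t) :
    ‖f a - f b‖ₑ ≤ poincareConst n s p * ENNReal.ofReal (t ^ s) *
      (fracGrad G s p f a + fracGrad G s p f b) := by
  have ht2 : 0 < t / 2 := by positivity
  have hne : NeZero (volume.restrict (ball b (t / 2))) :=
    ⟨by simpa using (measure_ball_pos volume b ht2).ne'⟩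
  have hfin : IsFiniteMeasure (volume.restrict (ball b (t / 2))) :=
    ⟨by simpa using measure_ball_lt_top⟩
  have hc : ∀ c ∈ ball b (t / 2), ‖b - c‖ ≤ t / 2 := fun c hc => by
    rw [← dist_eq_norm, dist_comm]; exact (mem_ball.1 hc).le
  have ha := setLAverage_enorm_sub_le hs hp hf (a := a) ht2 hG fun c h => by
    have := norm_sub_le_norm_sub_add_norm_sub a b c
    linarith [hc c h]
  have hb := setLAverage_enorm_sub_le hs hp hf (a := b) ht2 hG fun c h => by linarith [hc c h]
  calc ‖f a - f b‖ₑ = ⨍⁻ _c in ball b (t / 2), ‖f a - f b‖ₑ ∂volume := (laverage_const _ _).symm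
    _ ≤ (⨍⁻ c in ball b (t / 2), ‖f a - f c‖ₑ ∂volume) + ⨍⁻ c in ball b (t / 2), ‖f b - f c‖ₑ ∂volume := by
        simp only [laverage_eq, ← ENNReal.add_div]
        gcongr
        rw [← lintegral_add_left (by fun_prop)]
        refine lintegral_mono fun c => ?_
        rw [← enorm_neg (f b - f c), neg_sub, ← sub_add_sub_cancel (f a) (f c) (f b)]
        exact enorm_add_le _ _
    _ ≤ _ := by
        rw [mul_add]
        refine (add_le_add ha hb).trans ?_
        gcongr <;> linarith

theorem ballAverage_le_of_le_radius (hs : 0 < s) (hp : 1 < p) (hf : Measurable f)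
    (hGm : MeasurableSet G) {x y : EuclideanSpace ℝ (Fin n)} {r t : ℝ} (ht : 0 < t) (htr : t ≤ r)
    (hrD : r ≤ D) (hxy : 2 * ‖x - y‖ ≤ t) (hG : ball x r ⊆ G) :
    ballAverage f x r ≤ ballAverage f y (r - t) +
      poincareConst n s p * ENNReal.ofReal (t ^ s) * (fracGradMax G s p D f x + fracGradMax G s p D f y) := by
  have hr : 0 < r := ht.trans_le htr
  set g := G.indicator (fracGrad G s p f) with hg
  have hgm : Measurable g := (measurable_fracGrad G s p hf).indicator hGm
  have hne : NeZero (volume.restrict (ball (0 : EuclideanSpace ℝ (Fin n)) 1)) :=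
    ⟨by simpa using (measure_ball_pos volume _ one_pos).ne'⟩
  have hfin : IsFiniteMeasure (volume.restrict (ball (0 : EuclideanSpace ℝ (Fin n)) 1)) :=
    ⟨by simpa using measure_ball_lt_top⟩
  have hfa : Measurable fun z => ‖f z‖ₑ := by fun_prop
  have hpt : ∀ z ∈ ball (0 : EuclideanSpace ℝ (Fin n)) 1, ‖f (x + r • z)‖ₑ ≤
      ‖f (y + (r - t) • z)‖ₑ + poincareConst n s p * ENNReal.ofReal (t ^ s) *
        (g (x + r • z) + g (y + (r - t) • z)) := by
    intro z hz
    have hz1 : ‖z‖ < 1 := by simpa using hz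
    have hxa : x + r • z ∈ G := hG (by
      rw [mem_ball, dist_eq_norm, add_sub_cancel_left, norm_smul, Real.norm_of_nonneg hr.le]
      nlinarith)
    -- Shrinking the radius by t leaves room: |x-y| + (r-t) + t/2 ≤ r, as |x-y| ≤ t/2.
    have hbG : ball (y + (r - t) • z) (t / 2) ⊆ G := by
      refine (ball_subset_ball' ?_).trans hG
      have : dist (y + (r - t) • z) x ≤ ‖x - y‖ + (r - t) * ‖z‖ := by
        rw [dist_eq_norm, add_sub_right_comm, ← norm_sub_rev y x]
        refine (norm_add_le _ _).trans ?_
        rw [norm_smul, Real.norm_of_nonneg (by linarith)]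
      nlinarith [norm_nonneg z]
    have hyb := hbG (mem_ball_self (by positivity))
    have hab : ‖x + r • z - (y + (r - t) • z)‖ ≤ 3 / 2 * t := by
      have : x + r • z - (y + (r - t) • z) = (x - y) + t • z := by module
      rw [this]
      refine (norm_add_le _ _).trans ?_
      rw [norm_smul, Real.norm_of_nonneg ht.le]
      nlinarith
    have := enorm_sub_le_fracGrad hs hp hf ht hbG hab
    rw [hg, indicator_of_mem hxa, indicator_of_mem hyb]
    calc ‖f (x + r • z)‖ₑ = ‖f (y + (r - t) • z) + (f (x + r • z) - f (y + (r - t) • z))‖ₑ := by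
          rw [add_sub_cancel]
      _ ≤ _ := (enorm_add_le _ _).trans (by gcongr)
  have hgx : ⨍⁻ z in ball (0 : EuclideanSpace ℝ (Fin n)) 1, g (x + r • z) ∂volume ≤
      fracGradMax G s p D f x := by
    rw [← setLAverage_ball_eq_unitBall volume x hr hgm]
    exact (laverage_ball_le_truncMax _ hr hrD _ _).trans le_add_self
  have hgy : ⨍⁻ z in ball (0 : EuclideanSpace ℝ (Fin n)) 1, g (y + (r - t) • z) ∂volume ≤
      fracGradMax G s p D f y := by
    -- For r = t the ball at y degenerates to a point, which is why `fracGradMax` contains the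
    -- pointwise gradient as well as its maximal function.
    rcases htr.eq_or_lt with rfl | h
    · simp only [sub_self, zero_smul, add_zero, laverage_const]
      exact le_self_add
    · rw [← setLAverage_ball_eq_unitBall volume y (sub_pos.2 h) hgm]
      exact (laverage_ball_le_truncMax _ (sub_pos.2 h) (by linarith) _ _).trans le_add_self
  have hfy : ⨍⁻ z in ball (0 : EuclideanSpace ℝ (Fin n)) 1, ‖f (y + (r - t) • z)‖ₑ ∂volume =
      ballAverage f y (r - t) := by
    rcases htr.eq_or_lt with rfl | h
    · simp only [ballAverage, sub_self, zero_smul, add_zero, laverage_const, if_true]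
    · rw [ballAverage, if_neg (sub_pos.2 h).ne', setLAverage_ball_eq_unitBall volume y (sub_pos.2 h) hfa]
  rw [ballAverage, if_neg hr.ne', setLAverage_ball_eq_unitBall volume x hr hfa]
  calc ⨍⁻ z in ball (0 : EuclideanSpace ℝ (Fin n)) 1, ‖f (x + r • z)‖ₑ ∂volume
      ≤ (⨍⁻ z in ball (0 : EuclideanSpace ℝ (Fin n)) 1, ‖f (y + (r - t) • z)‖ₑ ∂volume) +
        poincareConst n s p * ENNReal.ofReal (t ^ s) *
          ((⨍⁻ z in ball (0 : EuclideanSpace ℝ (Fin n)) 1, g (x + r • z) ∂volume) +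
            ⨍⁻ z in ball (0 : EuclideanSpace ℝ (Fin n)) 1, g (y + (r - t) • z) ∂volume) := by
        simp only [laverage_eq, ← ENNReal.add_div, ← mul_div_assoc]
        gcongr
        rw [← lintegral_add_left (by fun_prop), ← lintegral_const_mul _ (by fun_prop),
          ← lintegral_add_left (by fun_prop)]
        exact setLIntegral_mono' measurableSet_ball hpt
    _ ≤ _ := by rw [hfy]; gcongr

theorem ballAverage_le_of_radius_lt (hs : 0 < s) (hp : 1 < p) (hf : Measurable f)
    {x : EuclideanSpace ℝ (Fin n)} {r t : ℝ} (hx : x ∈ G) (hr : 0 ≤ r) (hrt : r < t)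
    (hG : ball x r ⊆ G) :
    ballAverage f x r ≤ ‖f x‖ₑ + poincareConst n s p * ENNReal.ofReal (t ^ s) *
      fracGradMax G s p D f x := by
  rcases hr.eq_or_lt with rfl | hr
  · simp [ballAverage]
  have hne : NeZero (volume.restrict (ball x r)) :=
    ⟨by simpa using (measure_ball_pos volume x hr).ne'⟩
  have hfin : IsFiniteMeasure (volume.restrict (ball x r)) := ⟨by simpa using measure_ball_lt_top⟩
  have ha := setLAverage_enorm_sub_le hs hp hf (a := x) hr hG fun c h => by
    rw [← dist_eq_norm, dist_comm]; linarith [mem_ball.1 h]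
  rw [ballAverage, if_neg hr.ne']
  calc ⨍⁻ c in ball x r, ‖f c‖ₑ ∂volume ≤ (⨍⁻ _c in ball x r, ‖f x‖ₑ ∂volume) + ⨍⁻ c in ball x r, ‖f x - f c‖ₑ ∂volume := by
        simp only [laverage_eq, ← ENNReal.add_div]
        gcongr
        rw [← lintegral_add_left (by fun_prop)]
        refine lintegral_mono fun c => ?_
        rw [← enorm_neg (f x - f c), neg_sub]
        calc ‖f c‖ₑ = ‖f x + (f c - f x)‖ₑ := by rw [add_sub_cancel]
          _ ≤ _ := enorm_add_le _ _
    _ ≤ _ := by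
        rw [laverage_const]
        gcongr
        refine ha.trans ?_
        gcongr
        rw [fracGradMax, indicator_of_mem hx]
        exact le_self_add

/-- Radii r ≥ t at x are matched with r - t ≤ R y at y; radii r < t are matched with radius zero. -/
theorem maximalR_le_add (hs : 0 < s) (hp : 1 < p) (hf : Measurable f) (hGm : MeasurableSet G)
    {R : EuclideanSpace ℝ (Fin n) → ℝ} {x y : EuclideanSpace ℝ (Fin n)} {t : ℝ} (hx : x ∈ G)
    (ht : 0 < t) (hxy : 2 * ‖x - y‖ ≤ t) (hG : ball x (R x) ⊆ G) (hD : R x ≤ D)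
    (hy : 0 ≤ R y) (hR : R x ≤ R y + t) :
    maximalR R f x ≤ maximalR R f y + (poincareConst n s p * ENNReal.ofReal (t ^ s) *
      (fracGradMax G s p D f x + fracGradMax G s p D f y) + ‖f x - f y‖ₑ) := by
  have hle : ∀ r, 0 ≤ r → r ≤ R y → ballAverage f y r ≤ maximalR R f y := fun r h0 h =>
    le_iSup₂_of_le (f := fun r (_ : r ∈ Icc 0 (R y)) => ballAverage f y r) r ⟨h0, h⟩ le_rfl
  refine iSup₂_le fun r ⟨hr0, hr⟩ => ?_
  have hGr : ball x r ⊆ G := (ball_subset_ball hr).trans hG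
  rcases le_or_gt t r with h | h
  · refine (ballAverage_le_of_le_radius hs hp hf hGm ht h (hr.trans hD) hxy hGr).trans ?_
    rw [← add_assoc]
    refine le_trans ?_ le_self_add
    gcongr
    exact hle _ (by linarith) (by linarith)
  · refine (ballAverage_le_of_radius_lt (D := D) hs hp hf hx hr0 h hGr).trans ?_
    have h1 : ‖f x‖ₑ ≤ maximalR R f y + ‖f x - f y‖ₑ := by
      calc ‖f x‖ₑ = ‖f y + (f x - f y)‖ₑ := by rw [add_sub_cancel]
        _ ≤ ‖f y‖ₑ + ‖f x - f y‖ₑ := enorm_add_le _ _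
        _ ≤ _ := by
          gcongr
          simpa [ballAverage] using hle 0 le_rfl hy
    rw [add_comm (_ * _) ‖f x - f y‖ₑ, ← add_assoc]
    gcongr
    exact le_self_add

/-- Serves the almost everywhere finiteness. -/
theorem maximalR_le_enorm_add {R : EuclideanSpace ℝ (Fin n) → ℝ} {x : EuclideanSpace ℝ (Fin n)}
    (hG : ball x (R x) ⊆ G) (hD : R x ≤ D) :
    maximalR R f x ≤ ‖f x‖ₑ + truncMax volume D (G.indicator fun y => ‖f y‖ₑ) x := by
  refine iSup₂_le fun r ⟨hr0, hr⟩ => ?_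
  rcases hr0.eq_or_lt with rfl | h
  · simp [ballAverage]
  · rw [ballAverage, if_neg h.ne']
    refine le_trans (le_of_eq ?_) ((laverage_ball_le_truncMax _ h (hr.trans hD) _ _).trans le_add_self)
    refine setLAverage_congr_fun measurableSet_ball fun y hy => ?_
    rw [indicator_of_mem (hG (ball_subset_ball hr hy))]

end FractionalGradient

/-! ### Consequences of the bound by the distance to the boundary. -/

section Geometry

open Metric Set

variable {E : Type*} [NormedAddCommGroup E] [NormedSpace ℝ E]

/-- A ball is connected, so if it misses the frontier and meets G it cannot leave G. -/
theorem ball_subset_of_le_infEDist_frontier {G : Set E} (hG : IsOpen G) {x : E} (hx : x ∈ G)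
    {r : ℝ} (h : ENNReal.ofReal r ≤ infEDist x (frontier G)) : ball x r ⊆ G := by
  rcases le_or_gt r 0 with hr | hr
  · simp [ball_eq_empty.2 hr]
  refine (convex_ball x r).isPreconnected.subset_left_of_subset_union hG
    isClosed_closure.isOpen_compl (disjoint_compl_right.mono_left subset_closure |>.mono_right
      subset_rfl) (fun z hz => ?_) ⟨x, mem_ball_self hr, hx⟩
  by_contra hcon
  simp only [mem_union, mem_compl_iff, not_or, not_not] at hcon
  have hz' : z ∈ frontier G := by
    rw [hG.frontier_eq]
    exact ⟨hcon.2, hcon.1⟩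
  have h1 := h.trans (infEDist_le_edist_of_mem hz')
  rw [edist_comm, edist_dist] at h1
  have := (ENNReal.ofReal_le_ofReal_iff dist_nonneg).1 h1
  exact absurd (mem_ball.1 hz) (not_lt.2 this)

/-- Nontriviality makes the frontier of a bounded nonempty set nonempty. -/
theorem le_diam_of_le_infEDist_frontier [Nontrivial E] {G : Set E} (hb : Bornology.IsBounded G)
    {x : E} (hx : x ∈ G) {r : ℝ} (h : ENNReal.ofReal r ≤ infEDist x (frontier G)) :
    r ≤ diam G := by
  have hne : G ≠ univ := by
    rintro rfl
    exact NormedSpace.unbounded_univ ℝ E hb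
  obtain ⟨z, hz⟩ := nonempty_frontier_iff.2 ⟨⟨x, hx⟩, hne⟩
  have h1 := h.trans (infEDist_le_edist_of_mem hz)
  rw [edist_dist] at h1
  refine ((ENNReal.ofReal_le_ofReal_iff dist_nonneg).1 h1).trans ?_
  rw [← diam_closure]
  exact dist_le_diam_of_mem hb.closure (subset_closure hx) (frontier_subset_closure hz)

end Geometry

/-! ### Integration of the pointwise estimate. -/

section Seminorm

open Metric Set

variable {n : ℕ}

theorem lintegral_ball_norm_rpow_lt_top [NeZero n] {ε : ℝ} (hε : 0 < ε) (D : ℝ) :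
    ∫⁻ h in ball (0 : EuclideanSpace ℝ (Fin n)) D, ENNReal.ofReal (‖h‖ ^ (ε - n)) < ∞ := by
  have hint : IntegrableOn (fun h : EuclideanSpace ℝ (Fin n) => ‖h‖ ^ (ε - n)) (ball 0 D) := by
    refine integrableOn_ball_of_norm_le_rpow (C := 1) (α := n - ε) ?_ ?_ ?_ ?_
    · rw [finrank_euclideanSpace_fin]
      exact NeZero.one_le
    · rw [finrank_euclideanSpace_fin]
      linarith
    · refine ae_of_all _ fun x => ?_
      rw [one_mul, neg_sub, Real.norm_of_nonneg (by positivity)]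
    · exact Measurable.aestronglyMeasurable (by fun_prop)
  exact hint.lintegral_lt_top

theorem setLIntegral_norm_sub_rpow_le {G : Set (EuclideanSpace ℝ (Fin n))} {D : ℝ}
    {x : EuclideanSpace ℝ (Fin n)} (hG : G ⊆ ball x D) (a : ℝ) :
    ∫⁻ y in G, ENNReal.ofReal (‖x - y‖ ^ a) ≤
      ∫⁻ h in ball (0 : EuclideanSpace ℝ (Fin n)) D, ENNReal.ofReal (‖h‖ ^ a) := by
  refine (lintegral_mono_set hG).trans (le_of_eq ?_)
  rw [← lintegral_indicator measurableSet_ball, ← lintegral_indicator measurableSet_ball,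
    ← lintegral_sub_left_eq_self ((ball (0 : EuclideanSpace ℝ (Fin n)) D).indicator _) x]
  refine lintegral_congr fun y => ?_
  have : y ∈ ball x D ↔ x - y ∈ ball (0 : EuclideanSpace ℝ (Fin n)) D := by
    rw [mem_ball, mem_ball_zero_iff, dist_eq_norm, norm_sub_rev]
  by_cases h : y ∈ ball x D
  · rw [indicator_of_mem h, indicator_of_mem (this.1 h)]
  · rw [indicator_of_notMem h, indicator_of_notMem (fun h' => h (this.2 h'))]

theorem fracSeminorm_congr_ae {G : Set (EuclideanSpace ℝ (Fin n))} (s p : ℝ)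
    {u v : EuclideanSpace ℝ (Fin n) → ℝ} (h : u =ᵐ[volume.restrict G] v) :
    fracSeminorm G s p u = fracSeminorm G s p v := by
  unfold fracSeminorm
  congr 1
  refine lintegral_congr_ae ?_
  filter_upwards [h] with x hx
  refine lintegral_congr_ae ?_
  filter_upwards [h] with y hy
  rw [hx, hy]

/-- Equality at x itself is required because radius zero is admissible. -/
theorem maximalR_congr_ae {G : Set (EuclideanSpace ℝ (Fin n))}
    {R f g : EuclideanSpace ℝ (Fin n) → ℝ} (h : f =ᵐ[volume.restrict G] g)
    {x : EuclideanSpace ℝ (Fin n)} (hx : f x = g x) (hG : ball x (R x) ⊆ G) :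
    maximalR R f x = maximalR R g x := by
  unfold maximalR
  refine iSup_congr fun r => iSup_congr fun hr => ?_
  unfold ballAverage
  rw [hx]
  congr 1
  refine laverage_congr ?_
  have := ae_restrict_of_ae_restrict_of_subset ((ball_subset_ball hr.2).trans hG) h
  filter_upwards [this] with y hy
  rw [hy]

theorem enorm_toReal_sub_toReal_le {a b c : ℝ≥0∞} (ha : a ≠ ∞) (hb : b ≠ ∞) (h : a ≤ b + c)
    (h' : b ≤ a + c) : ‖a.toReal - b.toReal‖ₑ ≤ c := by
  rcases eq_or_ne c ∞ with rfl | hc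
  · exact le_top
  rw [Real.enorm_eq_ofReal_abs, ← ENNReal.ofReal_toReal hc]
  refine ENNReal.ofReal_le_ofReal (abs_sub_le_iff.2 ⟨?_, ?_⟩)
  · have := ENNReal.toReal_mono (ENNReal.add_ne_top.2 ⟨hb, hc⟩) h
    rw [ENNReal.toReal_add hb hc] at this
    linarith
  · have := ENNReal.toReal_mono (ENNReal.add_ne_top.2 ⟨ha, hc⟩) h'
    rw [ENNReal.toReal_add ha hc] at this
    linarith

/-- From a pointwise difference estimate to a bound of Gagliardo integrands. -/
theorem gagliardo_integrand_le {σ s α p D Λ : ℝ} (hs : 0 < s) (hα1 : α < 1)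
    (hp : 1 < p) (hσα : σ < α * s) (hΛ : 0 ≤ Λ)
    {K X Y : ℝ≥0∞} {u f : EuclideanSpace ℝ (Fin n) → ℝ} {x y : EuclideanSpace ℝ (Fin n)}
    (hD : ‖x - y‖ ≤ D)
    (h : x ≠ y → ‖u x - u y‖ₑ ≤
      K * ENNReal.ofReal ((Λ * ‖x - y‖ ^ α) ^ s) * (X + Y) + ‖f x - f y‖ₑ) :
    ENNReal.ofReal (|u x - u y| ^ p / ‖x - y‖ ^ ((n : ℝ) + σ * p)) ≤
      2 ^ (p - 1) * 2 ^ (p - 1) * (K * ENNReal.ofReal (Λ ^ s)) ^ p *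
        (ENNReal.ofReal (‖x - y‖ ^ ((α * s - σ) * p - n)) * (X ^ p + Y ^ p)) +
      2 ^ (p - 1) * ENNReal.ofReal (D ^ ((s - σ) * p)) *
        ENNReal.ofReal (|f x - f y| ^ p / ‖x - y‖ ^ ((n : ℝ) + s * p)) := by
  have hp0 : 0 < p := by linarith
  have hsσ : 0 < s - σ := by nlinarith
  rcases eq_or_ne x y with rfl | hxy
  · simp [Real.zero_rpow hp0.ne']
  have hρ : 0 < ‖x - y‖ := norm_pos_iff.2 (sub_ne_zero.2 hxy)
  set ρ := ‖x - y‖ with hρdef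
  have hD0 : 0 < D := hρ.trans_le hD
  have hdiv : ∀ (v : EuclideanSpace ℝ (Fin n) → ℝ) (q : ℝ), ENNReal.ofReal (|v x - v y| ^ p / ρ ^ q) =
      ‖v x - v y‖ₑ ^ p * ENNReal.ofReal (ρ ^ (-q)) := by
    intro v q
    rw [Real.enorm_eq_ofReal_abs, ENNReal.ofReal_rpow_of_nonneg (abs_nonneg _) hp0.le,
      ← ENNReal.ofReal_mul (by positivity), Real.rpow_neg hρ.le, div_eq_mul_inv]
  have h1 : ‖u x - u y‖ₑ ^ p ≤ 2 ^ (p - 1) * (2 ^ (p - 1) *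
      (K * ENNReal.ofReal (Λ ^ s)) ^ p * ENNReal.ofReal (ρ ^ (α * s * p)) * (X ^ p + Y ^ p) +
      ‖f x - f y‖ₑ ^ p) := by
    refine (ENNReal.rpow_le_rpow (h hxy) hp0.le).trans
      ((ENNReal.rpow_add_le_mul_rpow_add_rpow _ _ hp.le).trans ?_)
    gcongr
    rw [Real.mul_rpow hΛ (by positivity), ← Real.rpow_mul hρ.le, ENNReal.ofReal_mul (by positivity),
      ← mul_assoc K, ENNReal.mul_rpow_of_nonneg _ _ hp0.le,
      ENNReal.mul_rpow_of_nonneg (K * _) _ hp0.le,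
      ENNReal.ofReal_rpow_of_nonneg (p := p) (x := ρ ^ (α * s)) (by positivity) hp0.le, ← Real.rpow_mul hρ.le]
    refine (mul_le_mul_right (ENNReal.rpow_add_le_mul_rpow_add_rpow X Y hp.le) _).trans
      (le_of_eq ?_)
    ring
  have h2 : ENNReal.ofReal (ρ ^ (α * s * p)) * ENNReal.ofReal (ρ ^ (-((n : ℝ) + σ * p))) =
      ENNReal.ofReal (ρ ^ ((α * s - σ) * p - n)) := by
    rw [← ENNReal.ofReal_mul (by positivity), ← Real.rpow_add hρ]
    ring_nf
  -- The surplus factor ρ^((s-σ)p) has positive exponent, since σ < αs < s, so it is at most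
  -- D^((s-σ)p).
  have h3 : ENNReal.ofReal (ρ ^ (-((n : ℝ) + σ * p))) ≤
      ENNReal.ofReal (D ^ ((s - σ) * p)) * ENNReal.ofReal (ρ ^ (-((n : ℝ) + s * p))) := by
    rw [← ENNReal.ofReal_mul (by positivity)]
    refine ENNReal.ofReal_le_ofReal ?_
    have : ρ ^ (-((n : ℝ) + σ * p)) = ρ ^ ((s - σ) * p) * ρ ^ (-((n : ℝ) + s * p)) := by
      rw [← Real.rpow_add hρ]
      ring_nf
    rw [this]
    gcongr
  rw [hdiv, hdiv]
  calc _ ≤ 2 ^ (p - 1) * (2 ^ (p - 1) *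
      (K * ENNReal.ofReal (Λ ^ s)) ^ p * ENNReal.ofReal (ρ ^ (α * s * p)) * (X ^ p + Y ^ p) +
      ‖f x - f y‖ₑ ^ p) * ENNReal.ofReal (ρ ^ (-((n : ℝ) + σ * p))) := by gcongr
    _ = 2 ^ (p - 1) * 2 ^ (p - 1) * (K * ENNReal.ofReal (Λ ^ s)) ^ p *
        ((ENNReal.ofReal (ρ ^ (α * s * p)) * ENNReal.ofReal (ρ ^ (-((n : ℝ) + σ * p)))) *
          (X ^ p + Y ^ p)) +
        2 ^ (p - 1) * (‖f x - f y‖ₑ ^ p * ENNReal.ofReal (ρ ^ (-((n : ℝ) + σ * p)))) := by ring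
    _ ≤ 2 ^ (p - 1) * 2 ^ (p - 1) * (K * ENNReal.ofReal (Λ ^ s)) ^ p *
        (ENNReal.ofReal (ρ ^ ((α * s - σ) * p - n)) * (X ^ p + Y ^ p)) +
        2 ^ (p - 1) * (‖f x - f y‖ₑ ^ p * (ENNReal.ofReal (D ^ ((s - σ) * p)) *
          ENNReal.ofReal (ρ ^ (-((n : ℝ) + s * p))))) := by
        rw [h2]
        gcongr
    _ = _ := by ring

/-- By Tonelli and the symmetry of the kernel, the two summands contribute equally. -/
theorem lintegral_lintegral_norm_rpow_mul_le {G : Set (EuclideanSpace ℝ (Fin n))}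
    (hGm : MeasurableSet G) {D : ℝ} (hG : ∀ x ∈ G, G ⊆ ball x D) (a : ℝ)
    {Ψ : EuclideanSpace ℝ (Fin n) → ℝ≥0∞} (hΨ : Measurable Ψ) :
    ∫⁻ x in G, ∫⁻ y in G, ENNReal.ofReal (‖x - y‖ ^ a) * (Ψ x + Ψ y) ≤
      2 * (∫⁻ h in ball (0 : EuclideanSpace ℝ (Fin n)) D, ENNReal.ofReal (‖h‖ ^ a)) *
        ∫⁻ x in G, Ψ x := by
  set I := ∫⁻ h in ball (0 : EuclideanSpace ℝ (Fin n)) D, ENNReal.ofReal (‖h‖ ^ a)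
  have h1 : ∫⁻ x in G, ∫⁻ y in G, ENNReal.ofReal (‖x - y‖ ^ a) * Ψ x ≤ I * ∫⁻ x in G, Ψ x := by
    rw [← lintegral_const_mul _ hΨ]
    refine setLIntegral_mono' hGm fun x hx => ?_
    rw [lintegral_mul_const _ (by fun_prop)]
    gcongr
    exact setLIntegral_norm_sub_rpow_le (hG x hx) a
  have h2 : ∫⁻ x in G, ∫⁻ y in G, ENNReal.ofReal (‖x - y‖ ^ a) * Ψ y =
      ∫⁻ x in G, ∫⁻ y in G, ENNReal.ofReal (‖x - y‖ ^ a) * Ψ x := by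
    rw [lintegral_lintegral_swap (Measurable.aemeasurable (by fun_prop))]
    simp_rw [norm_sub_rev]
  have hm : Measurable fun x => ∫⁻ y in G, ENNReal.ofReal (‖x - y‖ ^ a) * Ψ x :=
    Measurable.lintegral_prod_right' (f := fun z : _ × _ =>
      ENNReal.ofReal (‖z.1 - z.2‖ ^ a) * Ψ z.1) (by fun_prop)
  simp_rw [mul_add]
  calc _ = ∫⁻ x in G, ((∫⁻ y in G, ENNReal.ofReal (‖x - y‖ ^ a) * Ψ x) +
        ∫⁻ y in G, ENNReal.ofReal (‖x - y‖ ^ a) * Ψ y) := by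
        refine lintegral_congr fun x => ?_
        rw [lintegral_add_left (by fun_prop)]
    _ ≤ _ := by
        rw [lintegral_add_left hm, h2, mul_assoc, two_mul]
        exact add_le_add h1 h1

theorem lintegral_fracGradMax_rpow_le (n : ℕ) {p : ℝ} (hp : 1 < p) :
    ∃ C : ℝ≥0∞, C ≠ ∞ ∧ ∀ (G : Set (EuclideanSpace ℝ (Fin n))) (s D : ℝ)
      (f : EuclideanSpace ℝ (Fin n) → ℝ), MeasurableSet G → Measurable f →
      ∫⁻ x in G, fracGradMax G s p D f x ^ p ≤ C * fracSeminorm G s p f ^ p := by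
  have hp0 : 0 < p := by linarith
  obtain ⟨C, hC, h⟩ := lintegral_truncMax_rpow_le
    (volume : Measure (EuclideanSpace ℝ (Fin n))) hp
  refine ⟨2 ^ (p - 1) * (1 + C), ENNReal.mul_ne_top (ENNReal.rpow_ne_top_of_nonneg (by linarith)
    ENNReal.ofNat_ne_top) (ENNReal.add_ne_top.2 ⟨ENNReal.one_ne_top, hC⟩), fun G s D f hGm hf => ?_⟩
  set g := G.indicator (fracGrad G s p f) with hg
  have hgm : Measurable g := (measurable_fracGrad G s p hf).indicator hGm
  have hMm := measurable_truncMax (volume : Measure (EuclideanSpace ℝ (Fin n))) D g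
  have hgi : ∫⁻ x, g x ^ p = fracSeminorm G s p f ^ p := by
    rw [fracSeminorm_rpow G s hp0, ← lintegral_indicator hGm]
    refine lintegral_congr fun x => ?_
    by_cases hx : x ∈ G <;> simp [hg, hx, hp0]
  calc ∫⁻ x in G, fracGradMax G s p D f x ^ p
      ≤ ∫⁻ x, 2 ^ (p - 1) * (g x ^ p + truncMax volume D g x ^ p) :=
        (setLIntegral_le_lintegral _ _).trans
          (lintegral_mono fun x => ENNReal.rpow_add_le_mul_rpow_add_rpow _ _ hp.le)
    _ = 2 ^ (p - 1) * ((∫⁻ x, g x ^ p) + ∫⁻ x, truncMax volume D g x ^ p) := by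
        rw [lintegral_const_mul _ (by fun_prop), lintegral_add_left (by fun_prop)]
    _ ≤ 2 ^ (p - 1) * ((∫⁻ x, g x ^ p) + C * ∫⁻ x, g x ^ p) := by
        gcongr
        exact h D g hgm
    _ = _ := by rw [hgi]; ring

theorem ae_truncMax_indicator_lt_top {G : Set (EuclideanSpace ℝ (Fin n))} (hGm : MeasurableSet G)
    {p : ℝ} (hp : 1 < p) (D : ℝ) {f : EuclideanSpace ℝ (Fin n) → ℝ} (hf : Measurable f)
    (hfp : MemLp f (ENNReal.ofReal p) (volume.restrict G)) :
    ∀ᵐ x, truncMax volume D (G.indicator fun y => ‖f y‖ₑ) x < ∞ := by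
  have hp0 : 0 < p := by linarith
  obtain ⟨C, hC, h⟩ := lintegral_truncMax_rpow_le
    (volume : Measure (EuclideanSpace ℝ (Fin n))) hp
  have hgm : Measurable (G.indicator fun y => ‖f y‖ₑ) := Measurable.indicator (by fun_prop) hGm
  have hMm := measurable_truncMax (volume : Measure (EuclideanSpace ℝ (Fin n))) D
    (G.indicator fun y => ‖f y‖ₑ)
  have hfin := (eLpNorm_lt_top_iff_lintegral_rpow_enorm_lt_top (by simpa using hp0)
    ENNReal.ofReal_ne_top).1 hfp.2
  rw [ENNReal.toReal_ofReal hp0.le, ← lintegral_indicator hGm] at hfin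
  have hgi : ∫⁻ x, (G.indicator fun y => ‖f y‖ₑ) x ^ p = ∫⁻ x, G.indicator (fun y => ‖f y‖ₑ ^ p) x := by
    refine lintegral_congr fun x => ?_
    by_cases hx : x ∈ G <;> simp [hx, hp0]
  have hlt := (h D _ hgm).trans_lt (by rw [hgi]; exact ENNReal.mul_lt_top hC.lt_top hfin)
  filter_upwards [ae_lt_top (by fun_prop) hlt.ne] with x hx
  exact (ENNReal.rpow_lt_top_iff_of_pos hp0).1 hx

theorem exists_fracSeminorm_maximalR_le [NeZero n] {σ s α p L d : ℝ}
    (hs : 0 < s) (hα1 : α < 1) (hp : 1 < p) (hL : 0 ≤ L)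
    (hσα : σ < α * s) :
    ∃ C : ℝ≥0∞, C ≠ ∞ ∧ ∀ G : Set (EuclideanSpace ℝ (Fin n)), IsOpen G →
      Bornology.IsBounded G → diam G = d → ∀ R : EuclideanSpace ℝ (Fin n) → ℝ,
      (∀ x ∈ G, ∀ y ∈ G, |R x - R y| ≤ L * ‖x - y‖ ^ α) →
      (∀ x ∈ G, 0 ≤ R x ∧ ball x (R x) ⊆ G ∧ R x ≤ d) →
      ∀ f : EuclideanSpace ℝ (Fin n) → ℝ, Measurable f →
      (∀ᵐ x ∂volume.restrict G, maximalR R f x < ∞) →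
      fracSeminorm G σ p (fun x => (maximalR R f x).toReal) ≤ C * fracSeminorm G s p f := by
  have hp0 : 0 < p := by linarith
  obtain ⟨C₁, hC₁, hΦ⟩ := lintegral_fracGradMax_rpow_le n hp
  -- Strictly above the diameter, so open balls of radius `D` centred in G contain G; positive for
  -- every d.
  set D := |d| + 1 with hDdef
  have hdD : d < D := by linarith [le_abs_self d]
  have hD0 : 0 < D := by positivity
  -- With t = Λ|x-y|^α, the summand L yields R x ≤ R y + t, and the other yields 2|x-y| ≤ t through
  -- |x-y| ≤ D^(1-α)|x-y|^α.
  set Λ := L + 2 * D ^ (1 - α) with hΛ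
  have hΛ0 : 0 < Λ := by positivity
  set A : ℝ≥0∞ := 2 ^ (p - 1) * 2 ^ (p - 1) * (poincareConst n s p * ENNReal.ofReal (Λ ^ s)) ^ p
    with hA
  set B : ℝ≥0∞ := 2 ^ (p - 1) * ENNReal.ofReal (D ^ ((s - σ) * p)) with hB
  set I : ℝ≥0∞ := ∫⁻ h in ball (0 : EuclideanSpace ℝ (Fin n)) D,
    ENNReal.ofReal (‖h‖ ^ ((α * s - σ) * p - n)) with hI
  have hI' : I ≠ ∞ := (lintegral_ball_norm_rpow_lt_top (mul_pos (sub_pos.2 hσα) hp0) D).ne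
  have h2 : (2 : ℝ≥0∞) ^ (p - 1) ≠ ∞ :=
    ENNReal.rpow_ne_top_of_nonneg (by linarith) ENNReal.ofNat_ne_top
  have hA' : A ≠ ∞ := ENNReal.mul_ne_top (ENNReal.mul_ne_top h2 h2)
    (ENNReal.rpow_ne_top_of_nonneg hp0.le
      (ENNReal.mul_ne_top (poincareConst_ne_top n s hp0) ENNReal.ofReal_ne_top))
  have hB' : B ≠ ∞ := ENNReal.mul_ne_top h2 ENNReal.ofReal_ne_top
  refine ⟨(A * (2 * I * C₁) + B) ^ (1 / p), ENNReal.rpow_ne_top_of_nonneg (by positivity)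
    (ENNReal.add_ne_top.2 ⟨ENNReal.mul_ne_top hA' (ENNReal.mul_ne_top
      (ENNReal.mul_ne_top ENNReal.ofNat_ne_top hI') hC₁), hB'⟩), ?_⟩
  intro G hGo hGb hGd R hR hRG f hf hfin
  have hGm := hGo.measurableSet
  have hGball : ∀ x ∈ G, G ⊆ ball x D := fun x hx y hy => by
    have := dist_le_diam_of_mem hGb hy hx
    rw [mem_ball]
    linarith
  set Φ := fracGradMax G s p D f with hΦdef
  have hΦm : Measurable Φ := ((measurable_fracGrad G s p hf).indicator hGm).add
    (measurable_truncMax _ _ _)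
  have hone : ∀ x ∈ G, ∀ y ∈ G, x ≠ y → maximalR R f x ≤ maximalR R f y +
      (poincareConst n s p * ENNReal.ofReal ((Λ * ‖x - y‖ ^ α) ^ s) * (Φ x + Φ y) +
        ‖f x - f y‖ₑ) := by
    intro x hx y hy hxy
    have hρ : 0 < ‖x - y‖ := norm_pos_iff.2 (sub_ne_zero.2 hxy)
    have hρD : ‖x - y‖ ≤ D := by
      rw [← dist_eq_norm, dist_comm]
      exact (mem_ball.1 (hGball x hx hy)).le
    have hρα : 0 < ‖x - y‖ ^ α := by positivity
    refine maximalR_le_add hs hp hf hGm hx (by positivity) ?_ (hRG x hx).2.1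
      ((hRG x hx).2.2.trans hdD.le) (hRG y hy).1 ?_
    · have h1 : ‖x - y‖ = ‖x - y‖ ^ (1 - α) * ‖x - y‖ ^ α := by
        rw [← Real.rpow_add hρ, sub_add_cancel, Real.rpow_one]
      have h2 : ‖x - y‖ ^ (1 - α) ≤ D ^ (1 - α) :=
        Real.rpow_le_rpow hρ.le hρD (by linarith)
      have h3 : ‖x - y‖ ^ (1 - α) * ‖x - y‖ ^ α ≤ D ^ (1 - α) * ‖x - y‖ ^ α := by gcongr
      rw [hΛ, add_mul]
      nlinarith [mul_nonneg hL hρα.le]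
    · have h1 := (le_abs_self _).trans (hR x hx y hy)
      have h2 : 0 ≤ 2 * D ^ (1 - α) * ‖x - y‖ ^ α := by positivity
      rw [hΛ, add_mul]
      linarith
  -- Only monotonicity of the integral is applied to the left side, so measurability of `maximalR R
  -- f` never enters.
  have hpt : ∀ᵐ x ∂volume.restrict G, ∀ᵐ y ∂volume.restrict G,
      ENNReal.ofReal (|(maximalR R f x).toReal - (maximalR R f y).toReal| ^ p /
        ‖x - y‖ ^ ((n : ℝ) + σ * p)) ≤
      A * (ENNReal.ofReal (‖x - y‖ ^ ((α * s - σ) * p - n)) * (Φ x ^ p + Φ y ^ p)) +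
      B * ENNReal.ofReal (|f x - f y| ^ p / ‖x - y‖ ^ ((n : ℝ) + s * p)) := by
    filter_upwards [hfin, ae_restrict_mem hGm] with x hxf hx
    filter_upwards [hfin, ae_restrict_mem hGm] with y hyf hy
    refine gagliardo_integrand_le (u := fun x => (maximalR R f x).toReal) hs hα1 hp hσα
      hΛ0.le ?_ fun hxy => ?_
    · rw [← dist_eq_norm, dist_comm]
      exact (mem_ball.1 (hGball x hx hy)).le
    · refine enorm_toReal_sub_toReal_le hxf.ne hyf.ne (hone x hx y hy hxy) ?_
      have := hone y hy x hx hxy.symm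
      rwa [norm_sub_rev y x, add_comm (Φ y), ← enorm_neg (f y - f x), neg_sub] at this
  have hk : Measurable fun z : EuclideanSpace ℝ (Fin n) × EuclideanSpace ℝ (Fin n) =>
      ENNReal.ofReal (|f z.1 - f z.2| ^ p / ‖z.1 - z.2‖ ^ ((n : ℝ) + s * p)) := by fun_prop
  have hw : Measurable fun z : EuclideanSpace ℝ (Fin n) × EuclideanSpace ℝ (Fin n) =>
      ENNReal.ofReal (‖z.1 - z.2‖ ^ ((α * s - σ) * p - n)) * (Φ z.1 ^ p + Φ z.2 ^ p) := by fun_prop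
  have hpow : fracSeminorm G σ p (fun x => (maximalR R f x).toReal) ^ p ≤
      (A * (2 * I * C₁) + B) * fracSeminorm G s p f ^ p := by
    calc fracSeminorm G σ p (fun x => (maximalR R f x).toReal) ^ p
        = ∫⁻ x in G, ∫⁻ y in G, ENNReal.ofReal
            (|(maximalR R f x).toReal - (maximalR R f y).toReal| ^ p /
              ‖x - y‖ ^ ((n : ℝ) + σ * p)) := by
          rw [fracSeminorm, ← ENNReal.rpow_mul, one_div_mul_cancel hp0.ne', ENNReal.rpow_one]
      _ ≤ ∫⁻ x in G, ∫⁻ y in G,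
            (A * (ENNReal.ofReal (‖x - y‖ ^ ((α * s - σ) * p - n)) * (Φ x ^ p + Φ y ^ p)) +
            B * ENNReal.ofReal (|f x - f y| ^ p / ‖x - y‖ ^ ((n : ℝ) + s * p))) :=
          lintegral_mono_ae (hpt.mono fun x hx => lintegral_mono_ae hx)
      _ = A * (∫⁻ x in G, ∫⁻ y in G, ENNReal.ofReal (‖x - y‖ ^ ((α * s - σ) * p - n)) *
            (Φ x ^ p + Φ y ^ p)) + B * fracSeminorm G s p f ^ p := by
          rw [fracSeminorm, ← ENNReal.rpow_mul, one_div_mul_cancel hp0.ne', ENNReal.rpow_one,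
            ← lintegral_const_mul' _ _ hA', ← lintegral_const_mul' _ _ hB', ← lintegral_add_left]
          · refine lintegral_congr fun x => ?_
            rw [← lintegral_const_mul' _ _ hA', ← lintegral_const_mul' _ _ hB',
              ← lintegral_add_left]
            exact (hw.comp measurable_prodMk_left).const_mul A
          · exact hw.lintegral_prod_right'.const_mul A
      _ ≤ A * (2 * I * (C₁ * fracSeminorm G s p f ^ p)) + B * fracSeminorm G s p f ^ p := by
          gcongr
          refine (lintegral_lintegral_norm_rpow_mul_le hGm hGball _
            (Ψ := fun x => Φ x ^ p) (by fun_prop)).trans ?_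
          gcongr
          exact hΦ G s D f hGm hf
      _ = _ := by ring
  refine (ENNReal.rpow_le_rpow_iff hp0).1 (hpow.trans (le_of_eq ?_))
  rw [ENNReal.mul_rpow_of_nonneg _ _ hp0.le, ← ENNReal.rpow_mul, one_div_mul_cancel hp0.ne',
    ENNReal.rpow_one]

end Seminorm

/-! ### Dimension zero and the final assembly. -/

theorem fracSeminorm_of_subsingleton {n : ℕ} [Subsingleton (EuclideanSpace ℝ (Fin n))]
    (G : Set (EuclideanSpace ℝ (Fin n))) (s : ℝ) {p : ℝ} (hp : 0 < p)
    (u : EuclideanSpace ℝ (Fin n) → ℝ) : fracSeminorm G s p u = 0 := by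
  have : ∀ x y, |u x - u y| ^ p = 0 := fun x y => by
    rw [Subsingleton.elim x y, sub_self, abs_zero, Real.zero_rpow hp.ne']
  simp [fracSeminorm, this, hp]

theorem maximalR_le_of_subsingleton {n : ℕ} [Subsingleton (EuclideanSpace ℝ (Fin n))]
    (R f : EuclideanSpace ℝ (Fin n) → ℝ) (x : EuclideanSpace ℝ (Fin n)) :
    maximalR R f x ≤ ‖f x‖ₑ := by
  refine iSup₂_le fun r hr => ?_
  unfold ballAverage
  split_ifs
  · exact le_rfl
  · have : (fun y => ‖f y‖ₑ) = fun _ => ‖f x‖ₑ := funext fun y => by rw [Subsingleton.elim y x]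
    rw [this, setLAverage_eq, setLIntegral_const, mul_comm, mul_div_assoc]
    exact ENNReal.mul_div_le

theorem corollary5p5 (n : ℕ) (σ s α p L d : ℝ)
    (hs : 0 < s) (hs1 : s < 1) (hα : 0 < α) (hα1 : α < 1) (hp : 1 < p)
    (hL : 0 ≤ L) (hσ : 0 < σ) (hσα : σ < α * s) :
    ∃ C : ℝ, 0 < C ∧
      ∀ G : Set (EuclideanSpace ℝ (Fin n)),
        G.Nonempty → IsOpen G → Bornology.IsBounded G → Metric.diam G = d →
      ∀ R : EuclideanSpace ℝ (Fin n) → ℝ,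
        (∀ x ∈ G, ∀ y ∈ G, |R x - R y| ≤ L * ‖x - y‖ ^ α) →
        (∀ x ∈ G, 0 ≤ R x ∧ ENNReal.ofReal (R x) ≤ Metric.infEDist x (frontier G)) →
      ∀ f : EuclideanSpace ℝ (Fin n) → ℝ,
        MemLp f (ENNReal.ofReal p) (volume.restrict G) →
        (∀ᵐ x ∂(volume.restrict G), maximalR R f x < ∞) ∧
        fracSeminorm G σ p (fun x => (maximalR R f x).toReal)
          ≤ ENNReal.ofReal C * fracSeminorm G s p f := by
  have hp0 : 0 < p := by linarith
  -- In dimension zero the frontier is empty and R is not bounded by the diameter, but the seminorm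
  -- vanishes.
  rcases n.eq_zero_or_pos with rfl | hn
  · refine ⟨1, one_pos, fun G _ _ _ _ R _ _ f _ => ⟨ae_of_all _ fun x => ?_, ?_⟩⟩
    · exact (maximalR_le_of_subsingleton R f x).trans_lt enorm_lt_top
    · rw [fracSeminorm_of_subsingleton G σ hp0]
      exact zero_le
  have : NeZero n := ⟨hn.ne'⟩
  have : Nonempty (Fin n) := ⟨0⟩
  obtain ⟨C, hC, hmain⟩ := exists_fracSeminorm_maximalR_le (n := n) (d := d) hs hα1 hp hL hσα
  refine ⟨C.toReal + 1, by positivity, fun G _ hGo hGb hGd R hR hRG f hf => ?_⟩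
  have hRG' : ∀ x ∈ G, 0 ≤ R x ∧ Metric.ball x (R x) ⊆ G ∧ R x ≤ d := fun x hx =>
    ⟨(hRG x hx).1, ball_subset_of_le_infEDist_frontier hGo hx (hRG x hx).2,
      hGd ▸ le_diam_of_le_infEDist_frontier hGb hx (hRG x hx).2⟩
  -- Passing to a measurable representative changes both sides only on a null set of G, since all
  -- admissible balls lie in G.
  obtain ⟨f₀, hf₀, hff₀⟩ : ∃ f₀, Measurable f₀ ∧ f =ᵐ[volume.restrict G] f₀ :=
    ⟨hf.1.mk f, hf.1.stronglyMeasurable_mk.measurable, hf.1.ae_eq_mk⟩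
  have hf₀p := (memLp_congr_ae hff₀).1 hf
  have hM : ∀ᵐ x ∂volume.restrict G, maximalR R f x = maximalR R f₀ x := by
    filter_upwards [hff₀, ae_restrict_mem hGo.measurableSet] with x hx hxG
    exact maximalR_congr_ae hff₀ hx (hRG' x hxG).2.1
  have hfin : ∀ᵐ x ∂volume.restrict G, maximalR R f₀ x < ∞ := by
    filter_upwards [ae_restrict_mem hGo.measurableSet, ae_restrict_of_ae
      (ae_truncMax_indicator_lt_top hGo.measurableSet hp d hf₀ hf₀p)] with x hx hlt
    exact (maximalR_le_enorm_add (hRG' x hx).2.1 (hRG' x hx).2.2).trans_lt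
      (ENNReal.add_lt_top.2 ⟨enorm_lt_top, hlt⟩)
  refine ⟨?_, ?_⟩
  · filter_upwards [hM, hfin] with x hx hlt
    rwa [hx]
  · rw [fracSeminorm_congr_ae s p hff₀,
      fracSeminorm_congr_ae σ p (hM.mono fun x hx => congrArg ENNReal.toReal hx)]
    refine (hmain G hGo hGb hGd R hR hRG' f₀ hf₀ hfin).trans ?_
    gcongr
    rw [ENNReal.ofReal_add ENNReal.toReal_nonneg zero_le_one, ENNReal.ofReal_toReal hC]
    exact le_self_add
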